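/- Let $R$ be a reflexive binary relation on a set $U$. For $x\in U$ put $R(x)=\{y\in U : (x,y)\in R\}$, and for $X\subseteq U$ let \[ X^\blacktriangledown=\{x\in U : R(x)\subseteq X\},\qquad X^\blacktriangle=\{x\in U : R(x)\cap X\neq\emptyset\}. \] Let $\wp(U)^\blacktriangle=\{X^\blacktriangle : X\subseteq U\}$, ordered by inclusion (it is a complete lattice), and let $\mathrm{RS}=\{(X^\blacktriangledown,X^\blacktriangle) : X\subseteq U\}$, ordered coordinatewise by inclusion. Let $\mathrm{DM(RS)}$ be the Dedekind--MacNeille completion of $\mathrm{RS}$. Its elements are identified with pairs $(A,B)$, where $A$ is the intersection of the first coordinates of the rough sets above the element and $B$ is the union of the second coordinates of the rough sets below it; its negation is ${\sim}(A,B)=(U\setminus B,\,U\setminus A)$. In a complete lattice $L$, an element $j\neq 0$ is completely join-irreducible if $j=\bigvee S$ implies $j\in S$ for all $S\subseteq L$; $\mathcal J$ is the set of these elements. $L$ is spatial if $a=\bigvee\{j\in\mathcal J : j\le a\}$ for every $a\in L$, and completely distributive if $\bigwedge_{i\in I}\bigvee_{j\in J}a_{i,j}=\bigvee_{f\colon I\to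 J}\bigwedge_{i\in I}a_{i,f(i)}$ for all doubly indexed families in $L$. The set $\mathcal J$ has at most two levels if for all $j,k\in\mathcal J$, $j<k$ implies that $j$ is an atom of $L$. The pseudocomplement $x^*$ of $x$ is the greatest $z$ with $x\wedge z=0$, and the dual pseudocomplement $x^+$ is the least $z$ with $x\vee z=1$. A Kleene algebra is a bounded distributive lattice with a unary operation $\sim$ satisfying ${\sim}{\sim}x=x$, the two De Morgan laws, and $x\wedge{\sim}x\le y\vee{\sim}y$. It is pseudocomplemented if every element has a pseudocomplement (then every element also has a dual pseudocomplement), and it is then called regular if $x^*=y^*$ and $x^+=y^+$ imply $x=y$. The following are equivalent: (i) $\mathrm{DM(RS)}$ is spatial and completely distributive, and, with the negation $\sim$ above, it is a regular pseudocomplemented Kleene algebra; (ii) $\mathrm{DM(RS)}$ is a spatial and completely distributive lattice whose set $\mathcal J$ of completely join-irreducible elements has at most two levels; (iii) $\wp(U)^\blacktriangle$ is an atomistic Boolean lattice, that is, a bounded distributive complemented lattice in which every element is the join of the atoms below it. -/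

import Mathlib

/-! ### Lattice-theoretic notions -/

namespace RoughSet

universe u

/-- `p` is the pseudocomplement of `a`: the greatest `x` with `a ⊓ x = ⊥`. -/
def IsPseudocompl {L : Type u} [Lattice L] [BoundedOrder L] (a p : L) : Prop :=
  IsGreatest {x : L | a ⊓ x = ⊥} p

/-- `q` is the dual pseudocomplement of `a`: the least `x` with `a ⊔ x = ⊤`. -/
def IsDualPseudocompl {L : Type u} [Lattice L] [BoundedOrder L] (a q : L) : Prop :=
  IsLeast {x : L | a ⊔ x = ⊤} q

/-- The lattice satisfies the distributive law. -/
def IsDistributive (L : Type u) [Lattice L] : Prop :=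
  ∀ x y z : L, x ⊓ (y ⊔ z) = (x ⊓ y) ⊔ (x ⊓ z)

/-- A Boolean lattice: a bounded distributive lattice in which each element has a complement. -/
structure IsBooleanLattice (L : Type u) [Lattice L] [BoundedOrder L] : Prop where
  distributive : IsDistributive L
  complemented : ∀ a : L, ∃ b : L, a ⊓ b = ⊥ ∧ a ⊔ b = ⊤

/-- A De Morgan algebra with negation `neg`. -/
structure IsDeMorganAlgebra (L : Type u) [Lattice L] [BoundedOrder L] (neg : L → L) : Prop where
  distributive : IsDistributive L
  neg_neg : ∀ x, neg (neg x) = x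
  neg_sup : ∀ x y, neg (x ⊔ y) = neg x ⊓ neg y
  neg_inf : ∀ x y, neg (x ⊓ y) = neg x ⊔ neg y

/-- A Kleene algebra with negation `neg`. -/
structure IsKleeneAlgebra (L : Type u) [Lattice L] [BoundedOrder L] (neg : L → L) : Prop
    extends IsDeMorganAlgebra L neg where
  inf_neg_le_sup_neg : ∀ x y, x ⊓ neg x ≤ y ⊔ neg y

/-- A pseudocomplemented Kleene algebra: a Kleene algebra in which every element has a
pseudocomplement. -/
structure IsPseudocomplementedKleeneAlgebra (L : Type u) [Lattice L] [BoundedOrder L]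
    (neg : L → L) : Prop extends IsKleeneAlgebra L neg where
  exists_pseudocompl : ∀ a : L, ∃ p : L, IsPseudocompl a p

/-- In a pseudocomplemented Kleene algebra every element also has a dual pseudocomplement, so the
regularity condition below is about total operations. -/
theorem IsPseudocomplementedKleeneAlgebra.exists_dualPseudocompl {L : Type u} [Lattice L]
    [BoundedOrder L] {neg : L → L} (h : IsPseudocomplementedKleeneAlgebra L neg) (a : L) :
    ∃ q : L, IsDualPseudocompl a q := by
  have anti : ∀ x y : L, x ≤ y → neg y ≤ neg x := fun x y hxy => by
    have := h.neg_sup x y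
    rw [sup_eq_right.2 hxy] at this
    rw [this]; exact inf_le_left
  have hbot : neg ⊥ = ⊤ := top_le_iff.1 (by
    have := anti ⊥ (neg ⊤) bot_le
    rwa [h.neg_neg] at this)
  have htop : neg ⊤ = ⊥ := by rw [← hbot, h.neg_neg]
  obtain ⟨p, hp, hmax⟩ := h.exists_pseudocompl (neg a)
  refine ⟨neg p, ?_, fun x hx => ?_⟩
  · have hp' : neg a ⊓ p = ⊥ := hp
    have := congrArg neg hp'
    rwa [h.neg_inf, h.neg_neg, hbot] at this
  · have hx' : a ⊔ x = ⊤ := hx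
    have h1 : neg a ⊓ neg x = ⊥ := by rw [← h.neg_sup, hx', htop]
    have := anti _ _ (hmax (show neg x ∈ {y : L | neg a ⊓ y = ⊥} from h1))
    rwa [h.neg_neg] at this

/-- Regularity: two elements with the same pseudocomplement and the same dual pseudocomplement
are equal. -/
def IsRegular (L : Type u) [Lattice L] [BoundedOrder L] : Prop :=
  ∀ x y p q : L, IsPseudocompl x p → IsPseudocompl y p →
    IsDualPseudocompl x q → IsDualPseudocompl y q → x = y

/-- Complete distributivity of a complete lattice. -/
def IsCompletelyDistributive (L : Type u) [CompleteLattice L] : Prop :=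
  ∀ (I J : Type u) (a : I → J → L), ⨅ i, ⨆ j, a i j = ⨆ f : I → J, ⨅ i, a i (f i)

/-- `j` is completely join-irreducible. -/
def IsCompletelyJoinIrreducible {L : Type u} [CompleteLattice L] (j : L) : Prop :=
  j ≠ ⊥ ∧ ∀ S : Set L, j = sSup S → j ∈ S

/-- A complete lattice is spatial if each element is the join of the completely join-irreducible
elements below it. -/
def IsSpatial (L : Type u) [CompleteLattice L] : Prop :=
  ∀ a : L, a = sSup {j : L | IsCompletelyJoinIrreducible j ∧ j ≤ a}

/-- The set of completely join-irreducible elements has at most two levels. -/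
def HasAtMostTwoLevels (L : Type u) [CompleteLattice L] : Prop :=
  ∀ j k : L, IsCompletelyJoinIrreducible j → IsCompletelyJoinIrreducible k → j < k → IsAtom j

/-! ### Rough approximations and rough sets -/

variable {U : Type u} (R : U → U → Prop)

/-- The lower approximation `{x | R(x) ⊆ X}`, where `R(x) = {y | R x y}`. -/
def lower (X : Set U) : Set U := {x | {y | R x y} ⊆ X}

/-- The upper approximation `{x | R(x) ∩ X ≠ ∅}`. -/
def upper (X : Set U) : Set U := {x | ({y | R x y} ∩ X).Nonempty}

theorem lower_compl (X : Set U) : lower R Xᶜ = (upper R X)ᶜ := by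
  ext x
  simp only [lower, upper, Set.mem_ofPred_eq, Set.mem_compl_iff, Set.not_nonempty_iff_eq_empty,
    ← Set.disjoint_iff_inter_eq_empty, Set.disjoint_left, Set.subset_def]

theorem upper_compl (X : Set U) : upper R Xᶜ = (lower R X)ᶜ := by
  rw [← compl_inj_iff, ← lower_compl, compl_compl, compl_compl]

/-- The set of all upper approximations, ordered by inclusion. -/
abbrev UpperApprox : Type u := {Y : Set U // ∃ X : Set U, Y = upper R X}

theorem sUnion_upperApprox (𝓗 : Set (UpperApprox R)) :
    ∃ X : Set U, (⋃ Y ∈ 𝓗, (Y : Set U)) = upper R X := by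
  refine ⟨⋃ X ∈ {X : Set U | ∃ Y ∈ 𝓗, (Y : Set U) = upper R X}, X, ?_⟩
  ext x
  simp only [upper, Set.mem_iUnion, Set.mem_ofPred_eq, Set.Nonempty, Set.mem_inter_iff]
  constructor
  · rintro ⟨⟨Y, X, rfl⟩, hY, y, hxy, hy⟩
    exact ⟨y, hxy, X, ⟨_, hY, rfl⟩, hy⟩
  · rintro ⟨y, hxy, X, ⟨Y, hY, hYX⟩, hy⟩
    exact ⟨Y, hY, by rw [hYX]; exact ⟨y, hxy, hy⟩⟩

/-- The upper approximations form a complete lattice under inclusion; joins are unions. -/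
instance : CompleteLattice (UpperApprox R) :=
  letI : SupSet (UpperApprox R) := ⟨fun 𝓗 => ⟨⋃ Y ∈ 𝓗, (Y : Set U), sUnion_upperApprox R 𝓗⟩⟩
  completeLatticeOfSup (UpperApprox R) fun _ =>
    ⟨fun _ hY => Set.subset_biUnion_of_mem (u := fun Y : UpperApprox R => (Y : Set U)) hY,
      fun _ hZ => Set.iUnion₂_subset fun _ hY => hZ hY⟩

/-- The set of all rough sets `(lower X, upper X)`, ordered coordinatewise. -/
abbrev RS : Type u := {p : Set U × Set U // ∃ X : Set U, p = (lower R X, upper R X)}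

/-- The Dedekind-MacNeille completion of the ordered set of rough sets. -/
abbrev DMRS : Type u := DedekindCut (RS R)

variable {R}

/-- The negation `(A, B) ↦ (Bᶜ, Aᶜ)` on rough sets. -/
def RS.neg (s : RS R) : RS R :=
  ⟨(s.1.2ᶜ, s.1.1ᶜ), by
    obtain ⟨X, hX⟩ := s.2
    exact ⟨Xᶜ, by rw [hX, lower_compl, upper_compl]⟩⟩

theorem RS.neg_neg (s : RS R) : s.neg.neg = s :=
  Subtype.ext (by simp [RS.neg])

theorem RS.neg_le_iff (s t : RS R) : s.neg ≤ t ↔ t.neg ≤ s := by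
  simp only [← Subtype.coe_le_coe, RS.neg, Prod.le_def]
  constructor <;> rintro ⟨h₁, h₂⟩ <;>
    exact ⟨compl_le_of_compl_le h₂, compl_le_of_compl_le h₁⟩

theorem RS.le_neg_iff (s t : RS R) : s ≤ t.neg ↔ t ≤ s.neg := by
  rw [← RS.neg_neg s, RS.neg_le_iff, RS.neg_neg, RS.neg_neg]

theorem RS.neg_le_neg_iff (s t : RS R) : s.neg ≤ t.neg ↔ t ≤ s := by
  rw [RS.neg_le_iff, RS.neg_neg]

/-- The negation on the completion, the antitone extension of the negation of rough sets. In the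
coordinates `DMRS.fst`, `DMRS.snd` below it is `(A, B) ↦ (Bᶜ, Aᶜ)`. -/
def DMRS.neg (c : DMRS R) : DMRS R where
  extent := {s | s.neg ∈ c.right}
  intent := {s | s.neg ∈ c.left}
  upperPolar_extent := by
    ext t
    rw [Set.mem_ofPred_eq, ← DedekindCut.lowerBounds_right c, mem_upperPolar_iff]
    constructor
    · intro h s hs
      exact (RS.neg_le_iff s t).1 (h (show s.neg.neg ∈ c.right by rwa [RS.neg_neg]))
    · intro h s hs
      exact (RS.neg_le_neg_iff t s).1 (h hs)
  lowerPolar_intent := by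
    ext t
    rw [Set.mem_ofPred_eq, ← DedekindCut.upperBounds_left c, mem_lowerPolar_iff]
    constructor
    · intro h s hs
      exact (RS.le_neg_iff t s).1 (h (show s.neg.neg ∈ c.left by rwa [RS.neg_neg]))
    · intro h s hs
      exact (RS.neg_le_neg_iff s t).1 (h hs)

/-- The first coordinate `A` of an element of the completion: the intersection of the lower
approximations of the rough sets above it. -/
def DMRS.fst (c : DMRS R) : Set U := ⋂ s ∈ c.right, s.1.1

/-- The second coordinate `B` of an element of the completion: the union of the upper
approximations of the rough sets below it. -/
def DMRS.snd (c : DMRS R) : Set U := ⋃ s ∈ c.left, s.1.2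

theorem DMRS.fst_principal (s : RS R) : DMRS.fst (DedekindCut.principal s) = s.1.1 :=
  subset_antisymm (Set.biInter_subset_of_mem (t := fun s : RS R => s.1.1) (le_refl s))
    (Set.subset_iInter₂ fun _ ht => ht.1)

theorem DMRS.snd_principal (s : RS R) : DMRS.snd (DedekindCut.principal s) = s.1.2 :=
  subset_antisymm (Set.iUnion₂_subset fun _ ht => ht.2)
    (Set.subset_biUnion_of_mem (u := fun s : RS R => s.1.2) (le_refl s))

theorem DMRS.fst_neg (c : DMRS R) : (DMRS.neg c).fst = c.sndᶜ := by
  ext x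
  simp only [DMRS.fst, DMRS.snd, Set.mem_iInter, Set.mem_compl_iff, Set.mem_iUnion, not_exists]
  constructor
  · intro h s hs
    exact h s.neg (show s.neg.neg ∈ c.left by rwa [RS.neg_neg])
  · intro h s hs
    by_contra hx
    exact h s.neg hs hx

theorem DMRS.snd_neg (c : DMRS R) : (DMRS.neg c).snd = c.fstᶜ := by
  ext x
  simp only [DMRS.fst, DMRS.snd, Set.mem_iInter, Set.mem_compl_iff, Set.mem_iUnion, not_forall]
  constructor
  · rintro ⟨s, hs, hx⟩
    exact ⟨s.neg, hs, fun h => h hx⟩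
  · rintro ⟨s, hs, hx⟩
    exact ⟨s.neg, show s.neg.neg ∈ c.right by rwa [RS.neg_neg], hx⟩

end RoughSet

/-! The equivalence of (i) and (ii) is pure lattice theory. In a spatial, completely distributive
lattice the completely join-irreducible elements are completely join-prime and determine the order.
If such an element is not an atom and lies strictly below another one, it has the same
pseudocomplement and dual pseudocomplement as the join of everything strictly below it, so
regularity fails. With at most two levels, atoms are detected by pseudocomplements and the other
irreducibles by dual pseudocomplements.

The equivalence of (ii) and (iii) passes through `HasEnoughCorePoints`. For a core point `y`, the
set `upper R {y}` is a join-prime atom among the upper approximations, while `rough R {y}` and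
`rough R (above R y)` are join-prime in the completion, the former an atom and the latter maximal
among irreducibles. With enough core points these families are join-dense, which gives (ii) and
(iii). Conversely, complements in (iii), or join-primeness in (ii), supply the distinguished point
`p` of a core point. Minimality comes from being an atom in (iii); in (ii) it follows from
`not_rough_singleton_lt`, where negation would extend a two-element chain to a forbidden third
level. -/

namespace RoughSet

universe v

/-! ### Join-primes, spatiality and regularity in complete lattices -/

section Lattice

variable {L : Type v} [CompleteLattice L]

/-- `j` is completely join-prime. -/
def IsCompletelyJoinPrime (j : L) : Prop :=
  ∀ S : Set L, j ≤ sSup S → ∃ s ∈ S, j ≤ s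

theorem IsCompletelyJoinPrime.ne_bot {j : L} (h : IsCompletelyJoinPrime j) : j ≠ ⊥ := by
  rintro rfl
  obtain ⟨s, hs, -⟩ := h ∅ bot_le
  exact hs

theorem IsCompletelyJoinPrime.isCompletelyJoinIrreducible {j : L}
    (h : IsCompletelyJoinPrime j) : IsCompletelyJoinIrreducible j := by
  refine ⟨h.ne_bot, fun S hS => ?_⟩
  obtain ⟨s, hs, hjs⟩ := h S hS.le
  have : j = s := le_antisymm hjs (hS ▸ le_sSup hs)
  exact this ▸ hs

theorem IsCompletelyJoinPrime.le_or_le {j a b : L} (h : IsCompletelyJoinPrime j)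
    (hj : j ≤ a ⊔ b) : j ≤ a ∨ j ≤ b := by
  obtain ⟨s, hs, hjs⟩ := h {a, b} (by rwa [sSup_pair])
  rcases hs with rfl | rfl
  · exact Or.inl hjs
  · exact Or.inr hjs

/-- Apply complete distributivity to two rows, one constantly `j` and one listing `S`: the meet of
their joins is `j`, so irreducibility selects a single choice function, whose second value lies
above `j`. -/
theorem IsCompletelyJoinIrreducible.isCompletelyJoinPrime {j : L}
    (h : IsCompletelyJoinIrreducible j) (hL : IsCompletelyDistributive L) :
    IsCompletelyJoinPrime j := by
  intro S hS
  have key := hL (ULift Bool) S fun i s => if i.down then j else s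
  have hlow : (⨅ i : ULift.{v} Bool, ⨆ s : S, if i.down then j else (s : L)) = j := by
    rcases S.eq_empty_or_nonempty with rfl | ⟨s₀, hs₀⟩
    · exact absurd (le_bot_iff.1 (hS.trans sSup_empty.le)) h.1
    · apply le_antisymm
      · exact (iInf_le _ ⟨true⟩).trans (iSup_le fun s => by simp)
      · refine le_iInf fun i => ?_
        rcases i with ⟨_ | _⟩
        · simpa [← sSup_eq_iSup'] using hS
        · exact le_iSup_of_le ⟨s₀, hs₀⟩ (by simp)
  rw [hlow] at key
  obtain ⟨f, hf⟩ := h.2 _ key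
  refine ⟨f ⟨false⟩, (f ⟨false⟩).2, ?_⟩
  calc j ≤ _ := hf.ge
    _ ≤ _ := iInf_le _ ⟨false⟩
    _ = _ := by simp

/-- A join-prime below a meet of joins picks one index in each row, and these indices form the
required choice function. -/
theorem isCompletelyDistributive_of_joinPrime
    (h : ∀ a b : L, (∀ j, IsCompletelyJoinPrime j → j ≤ a → j ≤ b) → a ≤ b) :
    IsCompletelyDistributive L := by
  intro I J a
  apply le_antisymm
  · refine h _ _ fun j hj hle => ?_
    have : ∀ i, ∃ k, j ≤ a i k := fun i => by
      obtain ⟨_, ⟨k, rfl⟩, hk⟩ := hj _ (hle.trans (iInf_le _ i))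
      exact ⟨k, hk⟩
    choose f hf using this
    exact le_iSup_of_le f (le_iInf hf)
  · exact iSup_le fun f => le_iInf fun i => (iInf_le _ i).trans (le_iSup (a i) (f i))

theorem isSpatial_of_joinPrime
    (h : ∀ a b : L, (∀ j, IsCompletelyJoinPrime j → j ≤ a → j ≤ b) → a ≤ b) :
    IsSpatial L := fun _ =>
  le_antisymm (h _ _ fun _ hj hja => le_sSup ⟨hj.isCompletelyJoinIrreducible, hja⟩)
    (sSup_le fun _ hj => hj.2)

theorem IsSpatial.le_of_forall (hS : IsSpatial L) {a b : L}
    (h : ∀ j, IsCompletelyJoinIrreducible j → j ≤ a → j ≤ b) : a ≤ b := by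
  rw [hS a]
  exact sSup_le fun j hj => h j hj.1 hj.2

theorem IsSpatial.exists_le (hS : IsSpatial L) {a : L} (ha : a ≠ ⊥) :
    ∃ j, IsCompletelyJoinIrreducible j ∧ j ≤ a := by
  by_contra! hcon
  exact ha (le_bot_iff.1 (hS.le_of_forall fun j hj hja => absurd hja (hcon j hj)))

theorem isDistributive_of_spatial (hS : IsSpatial L) (hL : IsCompletelyDistributive L) :
    IsDistributive L := fun _ _ _ =>
  le_antisymm (hS.le_of_forall fun j hj hle => by
    rcases (hj.isCompletelyJoinPrime hL).le_or_le (hle.trans inf_le_right) with h | h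
    · exact (le_inf (hle.trans inf_le_left) h).trans le_sup_left
    · exact (le_inf (hle.trans inf_le_left) h).trans le_sup_right) le_inf_sup

theorem exists_isPseudocompl_of_spatial (hS : IsSpatial L) (hL : IsCompletelyDistributive L)
    (a : L) : ∃ p, IsPseudocompl a p := by
  refine ⟨sSup {x | a ⊓ x = ⊥}, ?_, fun x hx => le_sSup hx⟩
  refine le_bot_iff.1 (hS.le_of_forall fun j hj hle => ?_)
  obtain ⟨s, hs, hjs⟩ := hj.isCompletelyJoinPrime hL _ (hle.trans inf_le_right)
  exact (le_inf (hle.trans inf_le_left) hjs).trans (le_of_eq hs)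

theorem isRegular_of_twoLevels (hS : IsSpatial L) (hL : IsCompletelyDistributive L)
    (h2 : HasAtMostTwoLevels L) : IsRegular L := by
  suffices H : ∀ x y p q : L, IsPseudocompl x p → IsPseudocompl y p →
      IsDualPseudocompl x q → IsDualPseudocompl y q → x ≤ y from
    fun x y p q h₁ h₂ h₃ h₄ => le_antisymm (H x y p q h₁ h₂ h₃ h₄) (H y x p q h₂ h₁ h₄ h₃)
  intro x y p q hx hy hx' hy'
  refine hS.le_of_forall fun j hj hjx => ?_
  by_contra hjy
  -- An atom not below `y` is disjoint from `y`, hence below the common pseudocomplement `p`,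
  -- although it is below `x`. A non-atom is maximal among irreducibles, which makes `x` and the
  -- join of all `z` with `¬ j ≤ z` cover the top.
  by_cases hat : IsAtom j
  · have hjp : j ≤ p := hy.2 (by
      rw [Set.mem_ofPred_eq, inf_comm]
      exact ((IsAtom.le_iff hat).1 (inf_le_left : j ⊓ y ≤ j)).resolve_right
        fun h => hjy (inf_eq_left.1 h))
    exact hat.1 (le_bot_iff.1 ((le_inf hjx hjp).trans (le_of_eq hx.1)))
  · have hjq : j ≤ q :=
      ((hj.isCompletelyJoinPrime hL).le_or_le (le_top.trans (ge_of_eq hy'.1))).resolve_left hjy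
    have hq : q ≤ sSup {z | ¬ j ≤ z} := by
      refine hx'.2 (top_le_iff.1 (hS.le_of_forall fun k hk _ => ?_))
      by_cases hjk : j ≤ k
      · rcases hjk.eq_or_lt with rfl | hlt
        · exact hjx.trans le_sup_left
        · exact absurd (h2 j k hj hk hlt) hat
      · exact (le_sSup (show k ∈ {z | ¬ j ≤ z} from hjk)).trans le_sup_right
    obtain ⟨z, hz, hjz⟩ := hj.isCompletelyJoinPrime hL _ (hjq.trans hq)
    exact hz hjz

theorem twoLevels_of_isRegular (hS : IsSpatial L) (hL : IsCompletelyDistributive L)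
    (hpc : ∀ a : L, ∃ p, IsPseudocompl a p) (hdpc : ∀ a : L, ∃ q, IsDualPseudocompl a q)
    (hR : IsRegular L) : HasAtMostTwoLevels L := by
  intro j k hj hk hjk
  refine ⟨hj.1, fun b hb => ?_⟩
  by_contra hb0
  obtain ⟨l, hl, hlb⟩ := hS.exists_le hb0
  have hlj : l < j := hlb.trans_lt hb
  -- Irreducibility keeps `x` strictly below `j`, and `l ≤ x` keeps it nonzero. The element `k` is
  -- used for the dual pseudocomplements: `j ⊔ z = ⊤` forces `j < k ≤ z`.
  set x := sSup {i | i < j}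
  have hxj : x ≤ j := sSup_le fun i hi => le_of_lt hi
  have hne : x ≠ j := fun h => lt_irrefl j (hj.2 {i | i < j} h.symm)
  have hlt : ∀ i, i < j → i ≤ x := fun i hi => le_sSup hi
  have hp : ∀ z, j ⊓ z = ⊥ ↔ x ⊓ z = ⊥ := by
    refine fun z => ⟨fun h => le_bot_iff.1 ((inf_le_inf_right z hxj).trans h.le), fun h => ?_⟩
    refine le_bot_iff.1 (hS.le_of_forall fun i hi hle => ?_)
    rcases (hle.trans inf_le_left).eq_or_lt with rfl | hij
    · have : l ≤ x ⊓ z := le_inf (hlt l hlj) (hlj.le.trans (hle.trans inf_le_right))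
      exact absurd (le_bot_iff.1 (this.trans h.le)) hl.1
    · exact (le_inf (hlt i hij) (hle.trans inf_le_right)).trans h.le
  have hq : ∀ z, j ⊔ z = ⊤ ↔ x ⊔ z = ⊤ := by
    refine fun z => ⟨fun h => ?_, fun h => top_le_iff.1 (h.ge.trans (sup_le_sup_right hxj z))⟩
    have hkz : k ≤ z := ((hk.isCompletelyJoinPrime hL).le_or_le
      (le_top.trans h.ge)).resolve_left hjk.not_ge
    rw [sup_eq_right.2 (hjk.le.trans hkz)] at h
    rw [h, sup_top_eq]
  obtain ⟨p, hpj⟩ := hpc j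
  obtain ⟨q, hqj⟩ := hdpc j
  refine hne (hR x j p q ?_ hpj ?_ hqj)
  · simpa only [IsPseudocompl, hp] using hpj
  · simpa only [IsDualPseudocompl, hq] using hqj

end Lattice

/-- In a Dedekind-MacNeille completion, `s` is completely join-prime as soon as it splits the
ordered set with some `t`. -/
theorem isCompletelyJoinPrime_principal {P : Type v} [PartialOrder P] {s t : P}
    (h : ∀ u, s ≤ u ∨ u ≤ t) (hst : ¬ s ≤ t) :
    IsCompletelyJoinPrime (DedekindCut.principal s) := by
  intro S hS
  by_contra! hcon
  -- If no member of `S` is above `s`, the splitting puts every member below `t`, hence also the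
  -- join.
  refine hst (DedekindCut.principal_le_principal.1 (hS.trans (sSup_le fun c hc => ?_)))
  refine Concept.extent_subset_extent_iff.1 fun u hu => (h u).resolve_left fun hsu => ?_
  exact hcon c hc ((DedekindCut.principal_le_principal.2 hsu).trans
    (DedekindCut.principal_le_iff.2 hu))

/-! ### Approximations and core points -/

section Relation

variable {U : Type v} {R : U → U → Prop}

theorem mem_upper {X : Set U} {w : U} : w ∈ upper R X ↔ ∃ x ∈ X, R w x :=
  ⟨fun ⟨x, h₁, h₂⟩ => ⟨x, h₂, h₁⟩, fun ⟨x, h₂, h₁⟩ => ⟨x, h₁, h₂⟩⟩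

theorem mem_upper_singleton {w x : U} : w ∈ upper R {x} ↔ R w x := by
  simp [mem_upper]

theorem upper_mono {X Y : Set U} (h : X ⊆ Y) : upper R X ⊆ upper R Y := fun _ hw => by
  obtain ⟨x, hx, hwx⟩ := mem_upper.1 hw
  exact mem_upper.2 ⟨x, h hx, hwx⟩

theorem lower_mono {X Y : Set U} (h : X ⊆ Y) : lower R X ⊆ lower R Y :=
  fun _ hw _ hx => h (hw hx)

theorem upper_singleton_subset {X : Set U} {x : U} (hx : x ∈ X) : upper R {x} ⊆ upper R X :=
  upper_mono (Set.singleton_subset_iff.2 hx)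

variable (R) in
/-- The set `{w | R w y}` is minimal among the sets of this form, and some point of it
belongs only to those sets of this form that contain all of it. -/
def IsCorePoint (y : U) : Prop :=
  (∀ z, upper R {z} ⊆ upper R {y} → upper R {y} ⊆ upper R {z}) ∧
    ∃ p, R p y ∧ ∀ x, R p x → upper R {y} ⊆ upper R {x}

variable (R) in
/-- Every upper approximation is a union of sets `{w | R w y}` with `y` a core point. -/
def HasEnoughCorePoints : Prop :=
  ∀ w x, R w x → ∃ y, IsCorePoint R y ∧ R w y ∧ upper R {y} ⊆ upper R {x}

/-! ### The lattice of upper approximations -/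

theorem IsCorePoint.exists_subset {y : U} (hy : IsCorePoint R y) {X : Set U}
    (h : upper R {y} ⊆ upper R X) : ∃ x ∈ X, upper R {y} ⊆ upper R {x} := by
  obtain ⟨p, hp, hpx⟩ := hy.2
  obtain ⟨x, hx, h'⟩ := mem_upper.1 (h (mem_upper_singleton.2 hp))
  exact ⟨x, hx, hpx x h'⟩

variable (R) in
/-- An upper approximation, as an element of the lattice. -/
def upperApprox (X : Set U) : UpperApprox R := ⟨upper R X, X, rfl⟩

theorem upperApprox_le {X Y : Set U} :
    upperApprox R X ≤ upperApprox R Y ↔ upper R X ⊆ upper R Y := Iff.rfl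

theorem exists_eq_upperApprox (a : UpperApprox R) : ∃ X, a = upperApprox R X := by
  obtain ⟨_, X, rfl⟩ := a
  exact ⟨X, rfl⟩

theorem UpperApprox.coe_sSup (S : Set (UpperApprox R)) :
    ((sSup S : UpperApprox R) : Set U) = ⋃ Y ∈ S, (Y : Set U) := rfl

theorem UpperApprox.coe_sup (a b : UpperApprox R) :
    ((a ⊔ b : UpperApprox R) : Set U) = (a : Set U) ∪ b := by
  rw [← sSup_pair, UpperApprox.coe_sSup]
  simp

theorem UpperApprox.coe_bot : ((⊥ : UpperApprox R) : Set U) = ∅ := by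
  rw [← sSup_empty, UpperApprox.coe_sSup]
  simp

theorem upperApprox_singleton_ne_bot (hR : ∀ x, R x x) (x : U) : upperApprox R {x} ≠ ⊥ :=
  fun h => by
    have h' := congrArg Subtype.val h
    rw [UpperApprox.coe_bot] at h'
    exact Set.notMem_empty x (h' ▸ mem_upper_singleton.2 (hR x))

theorem exists_upperApprox_singleton_le {w : U} {a : UpperApprox R} (hw : w ∈ (a : Set U)) :
    ∃ x, R w x ∧ upperApprox R {x} ≤ a := by
  obtain ⟨X, rfl⟩ := exists_eq_upperApprox a
  obtain ⟨x, hx, hwx⟩ := mem_upper.1 hw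
  exact ⟨x, hwx, upper_singleton_subset hx⟩

theorem HasEnoughCorePoints.le_of_forall (h : HasEnoughCorePoints R) {a b : UpperApprox R}
    (hab : ∀ y, IsCorePoint R y → upperApprox R {y} ≤ a → upperApprox R {y} ≤ b) : a ≤ b := by
  intro w hw
  obtain ⟨x, hwx, hx⟩ := exists_upperApprox_singleton_le hw
  obtain ⟨y, hy, hwy, hyx⟩ := h w x hwx
  exact hab y hy ((upperApprox_le.2 hyx).trans hx) (mem_upper_singleton.2 hwy)

/-- Joins are unions, so the distinguished point `p` already lies in one member of `S`. -/
theorem IsCorePoint.isCompletelyJoinPrime {y : U} (hy : IsCorePoint R y) :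
    IsCompletelyJoinPrime (upperApprox R {y}) := by
  intro S hS
  obtain ⟨p, hp, hpx⟩ := hy.2
  have hpS := hS (mem_upper_singleton.2 hp)
  rw [UpperApprox.coe_sSup] at hpS
  obtain ⟨a, ha, hpa⟩ := Set.mem_iUnion₂.1 hpS
  obtain ⟨x, hx, hxa⟩ := exists_upperApprox_singleton_le hpa
  exact ⟨a, ha, (upperApprox_le.2 (hpx x hx)).trans hxa⟩

theorem IsCorePoint.isAtom (hR : ∀ x, R x x) {y : U} (hy : IsCorePoint R y) :
    IsAtom (upperApprox R {y}) := by
  refine ⟨upperApprox_singleton_ne_bot hR y, fun b hb => ?_⟩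
  by_contra hb0
  have : (b : Set U).Nonempty := by
    rw [Set.nonempty_iff_ne_empty]
    exact fun h => hb0 (Subtype.ext (h.trans UpperApprox.coe_bot.symm))
  obtain ⟨w, hw⟩ := this
  obtain ⟨x, -, hx⟩ := exists_upperApprox_singleton_le hw
  exact hb.not_ge ((upperApprox_le.2 (hy.1 x (hx.trans hb.le))).trans hx)

theorem HasEnoughCorePoints.isAtomistic (hR : ∀ x, R x x) (h : HasEnoughCorePoints R) :
    IsAtomistic (UpperApprox R) := by
  refine CompleteLattice.isAtomistic_iff.2 fun a => ⟨{b | IsAtom b ∧ b ≤ a}, ?_, fun b hb => hb.1⟩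
  exact le_antisymm (h.le_of_forall fun y hy hya => le_sSup ⟨hy.isAtom hR, hya⟩)
    (sSup_le fun b hb => hb.2)

theorem HasEnoughCorePoints.isBooleanLattice (hR : ∀ x, R x x) (h : HasEnoughCorePoints R) :
    IsBooleanLattice (UpperApprox R) where
  distributive x y z := by
    refine le_antisymm (h.le_of_forall fun u hu hle => ?_) le_inf_sup
    rcases hu.isCompletelyJoinPrime.le_or_le (hle.trans inf_le_right) with h' | h'
    · exact (le_inf (hle.trans inf_le_left) h').trans le_sup_left
    · exact (le_inf (hle.trans inf_le_left) h').trans le_sup_right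
  complemented a := by
    -- The complement is the join of the atoms not below `a`.
    refine ⟨sSup {b | IsAtom b ∧ ¬ b ≤ a}, le_bot_iff.1 (h.le_of_forall fun y hy hle => ?_),
      top_le_iff.1 (h.le_of_forall fun y hy _ => ?_)⟩
    · obtain ⟨b, ⟨hb, hba⟩, hyb⟩ := hy.isCompletelyJoinPrime _ (hle.trans inf_le_right)
      rcases hb.le_iff.1 hyb with h' | h'
      · exact h'.le
      · exact absurd (h' ▸ hle.trans inf_le_left) hba
    · by_cases hya : upperApprox R {y} ≤ a
      · exact hya.trans le_sup_left
      · exact (le_sSup (show _ ∈ {b | IsAtom b ∧ ¬ b ≤ a} from ⟨hy.isAtom hR, hya⟩)).trans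
          le_sup_right

theorem hasEnoughCorePoints_of_isBooleanLattice (hR : ∀ x, R x x)
    (hA : IsAtomistic (UpperApprox R)) (hB : IsBooleanLattice (UpperApprox R)) :
    HasEnoughCorePoints R := by
  intro w x hwx
  obtain ⟨S, hS, hSat⟩ := CompleteLattice.isAtomistic_iff.1 hA (upperApprox R {x})
  have hw : w ∈ (upperApprox R {x} : Set U) := mem_upper_singleton.2 hwx
  rw [hS, UpperApprox.coe_sSup] at hw
  obtain ⟨a, ha, hwa⟩ := Set.mem_iUnion₂.1 hw
  have hat := hSat a ha
  have hax : a ≤ upperApprox R {x} := hS ▸ le_sSup ha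
  obtain ⟨y, hwy, hya⟩ := exists_upperApprox_singleton_le hwa
  obtain rfl : upperApprox R {y} = a :=
    (hat.le_iff.1 hya).resolve_left (upperApprox_singleton_ne_bot hR y)
  refine ⟨y, ⟨fun z hz => ?_, ?_⟩, hwy, hax⟩
  · exact upperApprox_le.1 ((hat.le_iff.1 (upperApprox_le.2 hz)).resolve_left
      (upperApprox_singleton_ne_bot hR z)).ge
  · obtain ⟨b, hb, hb'⟩ := hB.complemented (upperApprox R {y})
    have hnle : ¬ upperApprox R {y} ≤ b := fun hle => by
      rw [inf_eq_left.2 hle] at hb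
      exact hat.1 hb
    -- A point of the atom outside its complement `b` serves as `p`: by distributivity, any `upper R
    -- {z}` containing `p` meets the atom in a nonzero element, so contains it.
    obtain ⟨p, hp, hpb⟩ := Set.not_subset.1 hnle
    refine ⟨p, mem_upper_singleton.1 hp, fun z hz => ?_⟩
    have hd := hB.distributive (upperApprox R {z}) (upperApprox R {y}) b
    rw [hb', inf_top_eq] at hd
    have hpz : p ∈ (upperApprox R {z} : Set U) := mem_upper_singleton.2 hz
    rw [hd, UpperApprox.coe_sup] at hpz
    have hpz' := hpz.resolve_right fun h => hpb ((inf_le_right : _ ≤ b) h)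
    have hne : upperApprox R {z} ⊓ upperApprox R {y} ≠ ⊥ := fun h => by
      rw [h, UpperApprox.coe_bot] at hpz'
      exact hpz'
    have heq := (hat.le_iff.1 (inf_le_right : upperApprox R {z} ⊓ _ ≤ _)).resolve_left hne
    exact upperApprox_le.1 (heq.ge.trans inf_le_left)

/-! ### The completion of the ordered set of rough sets -/

variable (R) in
/-- The rough set of `X`. -/
def RS.mk (X : Set U) : RS R := ⟨(lower R X, upper R X), X, rfl⟩

theorem RS.exists_eq_mk (s : RS R) : ∃ X, s = RS.mk R X := by
  obtain ⟨_, X, rfl⟩ := s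
  exact ⟨X, rfl⟩

variable (R) in
/-- The rough set of `X`, as an element of the completion. -/
def rough (X : Set U) : DMRS R := DedekindCut.principal (RS.mk R X)

theorem rough_le_rough {X Y : Set U} :
    rough R X ≤ rough R Y ↔ lower R X ⊆ lower R Y ∧ upper R X ⊆ upper R Y :=
  DedekindCut.principal_le_principal

theorem rough_mono {X Y : Set U} (h : X ⊆ Y) : rough R X ≤ rough R Y :=
  rough_le_rough.2 ⟨lower_mono h, upper_mono h⟩

theorem DMRS.le_of_forall_rough_le {c d : DMRS R} (h : ∀ X, rough R X ≤ c → rough R X ≤ d) :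
    c ≤ d := by
  refine Concept.extent_subset_extent_iff.1 fun s hs => ?_
  obtain ⟨X, rfl⟩ := s.exists_eq_mk
  exact DedekindCut.principal_le_iff.1 (h X (DedekindCut.principal_le_iff.2 hs))

theorem DMRS.le_of_forall_le_rough {c d : DMRS R} (h : ∀ X, d ≤ rough R X → c ≤ rough R X) :
    c ≤ d := by
  refine Concept.intent_subset_intent_iff.1 fun s hs => ?_
  obtain ⟨X, rfl⟩ := s.exists_eq_mk
  exact DedekindCut.le_principal_iff.1 (h X (DedekindCut.le_principal_iff.2 hs))

theorem DMRS.neg_neg (c : DMRS R) : c.neg.neg = c := by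
  apply DedekindCut.ext
  ext s
  show s.neg.neg ∈ c.left ↔ _
  rw [RS.neg_neg]

theorem DMRS.neg_le_neg {c d : DMRS R} (h : c ≤ d) : d.neg ≤ c.neg := by
  refine Concept.extent_subset_extent_iff.1 fun s hs => ?_
  exact Concept.intent_subset_intent_iff.2 h hs

theorem DMRS.neg_le_neg_iff {c d : DMRS R} : d.neg ≤ c.neg ↔ c ≤ d :=
  ⟨fun h => by simpa only [DMRS.neg_neg] using DMRS.neg_le_neg h, DMRS.neg_le_neg⟩

theorem DMRS.le_neg_comm {c d : DMRS R} : c ≤ d.neg ↔ d ≤ c.neg := by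
  rw [← DMRS.neg_le_neg_iff, DMRS.neg_neg]

theorem DMRS.neg_le_comm {c d : DMRS R} : c.neg ≤ d ↔ d.neg ≤ c := by
  rw [← DMRS.neg_le_neg_iff, DMRS.neg_neg]

theorem RS.neg_mk (X : Set U) : (RS.mk R X).neg = RS.mk R Xᶜ :=
  Subtype.ext (by simp only [RS.neg, RS.mk, lower_compl, upper_compl])

theorem DMRS.neg_rough (X : Set U) : (rough R X).neg = rough R Xᶜ := by
  apply DedekindCut.ext
  ext s
  show RS.mk R X ≤ s.neg ↔ s ≤ RS.mk R Xᶜ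
  rw [RS.le_neg_iff, RS.neg_mk]

theorem DMRS.isDeMorganAlgebra (h : IsDistributive (DMRS R)) :
    IsDeMorganAlgebra (DMRS R) DMRS.neg where
  distributive := h
  neg_neg := DMRS.neg_neg
  neg_sup x y := by
    refine le_antisymm (le_inf (DMRS.neg_le_neg le_sup_left) (DMRS.neg_le_neg le_sup_right)) ?_
    rw [DMRS.le_neg_comm]
    exact sup_le (DMRS.le_neg_comm.1 inf_le_left) (DMRS.le_neg_comm.1 inf_le_right)
  neg_inf x y := by
    refine le_antisymm ?_ (sup_le (DMRS.neg_le_neg inf_le_left) (DMRS.neg_le_neg inf_le_right))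
    rw [DMRS.neg_le_comm]
    exact le_inf (DMRS.neg_le_comm.1 le_sup_left) (DMRS.neg_le_comm.1 le_sup_right)

theorem DMRS.isKleeneAlgebra (hR : ∀ x, R x x) (h : IsDistributive (DMRS R)) :
    IsKleeneAlgebra (DMRS R) DMRS.neg where
  toIsDeMorganAlgebra := DMRS.isDeMorganAlgebra h
  inf_neg_le_sup_neg x y := by
    -- By reflexivity, a rough set below its negation has empty lower approximation, and one above
    -- its negation has upper approximation `U`.
    refine DMRS.le_of_forall_rough_le fun X hX => DMRS.le_of_forall_le_rough fun Z hZ => ?_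
    have hX' : rough R X ≤ rough R Xᶜ := by
      rw [← DMRS.neg_rough]
      exact (hX.trans inf_le_right).trans (DMRS.neg_le_neg (hX.trans inf_le_left))
    have hZ' : rough R Zᶜ ≤ rough R Z := by
      rw [← DMRS.neg_rough]
      exact (DMRS.neg_le_neg (le_sup_left.trans hZ)).trans (le_sup_right.trans hZ)
    refine rough_le_rough.2 ⟨fun w hw => ?_, fun w _ => ?_⟩
    · exact absurd (hw (hR w)) ((rough_le_rough.1 hX').1 hw (hR w))
    · by_contra hw
      have hwZ : w ∈ upper R Zᶜ := mem_upper.2 ⟨w, fun h => hw (mem_upper.2 ⟨w, h, hR w⟩), hR w⟩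
      exact hw ((rough_le_rough.1 hZ').2 hwZ)

/-! ### From core points to the completion -/

variable (R) in
/-- The points `x` with `upper R {y} ⊆ upper R {x}`. -/
def above (y : U) : Set U := {x | upper R {y} ⊆ upper R {x}}

theorem rough_singleton_le_iff (hR : ∀ x, R x x) {y : U} {X : Set U} :
    rough R {y} ≤ rough R X ↔
      upper R {y} ⊆ upper R X ∧ ((∀ x, R y x → x = y) → y ∈ X) := by
  rw [rough_le_rough, and_comm]
  refine and_congr_right fun _ => ⟨fun h hy => h (show y ∈ lower R {y} from hy) (hR y), ?_⟩
  intro h v hv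
  obtain rfl : v = y := hv (hR v)
  intro x hx
  obtain rfl : x = v := hv hx
  exact h fun z hz => hv hz

/-- The condition on lower approximations comes for free: `x ∈ above R y` gives `R y x`, so `x = y`
whenever `y` is its own only successor. -/
theorem IsCorePoint.rough_singleton_le_iff (hR : ∀ x, R x x) {y : U} (hy : IsCorePoint R y)
    {X : Set U} : rough R {y} ≤ rough R X ↔ ∃ x ∈ X, x ∈ above R y := by
  rw [RoughSet.rough_singleton_le_iff hR]
  refine ⟨fun h => hy.exists_subset h.1, ?_⟩
  rintro ⟨x, hx, hxy⟩
  refine ⟨hxy.trans (upper_singleton_subset hx), fun hy' => ?_⟩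
  exact hy' x (mem_upper_singleton.1 (hxy (mem_upper_singleton.2 (hR y)))) ▸ hx

theorem IsCorePoint.le_or_le (hR : ∀ x, R x x) {y : U} (hy : IsCorePoint R y) (s : RS R) :
    RS.mk R {y} ≤ s ∨ s ≤ RS.mk R (above R y)ᶜ := by
  obtain ⟨X, rfl⟩ := s.exists_eq_mk
  by_cases h : ∃ x ∈ X, x ∈ above R y
  · exact Or.inl (DedekindCut.principal_le_principal.1 ((hy.rough_singleton_le_iff hR).2 h))
  · push Not at h
    exact Or.inr (DedekindCut.principal_le_principal.1 (rough_mono h))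

theorem IsCorePoint.not_le (hR : ∀ x, R x x) {y : U} (hy : IsCorePoint R y) :
    ¬ RS.mk R {y} ≤ RS.mk R (above R y)ᶜ := fun h => by
  obtain ⟨x, hx, hx'⟩ :=
    (hy.rough_singleton_le_iff hR).1 (DedekindCut.principal_le_principal.2 h)
  exact hx hx'

theorem IsCorePoint.isCompletelyJoinPrime_rough_singleton (hR : ∀ x, R x x) {y : U}
    (hy : IsCorePoint R y) : IsCompletelyJoinPrime (rough R {y}) :=
  isCompletelyJoinPrime_principal (hy.le_or_le hR) (hy.not_le hR)

/-- Negation carries the splitting pair of `rough R {y}` to a splitting pair for `rough R (above R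
y)`. -/
theorem IsCorePoint.isCompletelyJoinPrime_rough_above (hR : ∀ x, R x x) {y : U}
    (hy : IsCorePoint R y) : IsCompletelyJoinPrime (rough R (above R y)) := by
  refine isCompletelyJoinPrime_principal (t := (RS.mk R {y}).neg) (fun u => ?_) ?_
  · rcases hy.le_or_le hR u.neg with h' | h'
    · exact Or.inr ((RS.le_neg_iff _ _).1 h')
    · rw [← RS.neg_mk, RS.neg_le_neg_iff] at h'
      exact Or.inl h'
  · rw [RS.le_neg_iff, RS.neg_mk]
    exact hy.not_le hR

/-- The singletons control upper approximations, the sets `above R y` lower ones: `p` lies in the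
lower approximation of `above R y`, and its membership in that of `Z` forces `x ∈ Z`. -/
theorem HasEnoughCorePoints.rough_le_of_forall (hR : ∀ x, R x x) (h : HasEnoughCorePoints R)
    {X Z : Set U}
    (h₁ : ∀ y, IsCorePoint R y → rough R {y} ≤ rough R X → rough R {y} ≤ rough R Z)
    (h₂ : ∀ y, IsCorePoint R y → rough R (above R y) ≤ rough R X →
      rough R (above R y) ≤ rough R Z) : rough R X ≤ rough R Z := by
  refine rough_le_rough.2 ⟨fun w hw x hwx => ?_, fun w hw => ?_⟩
  · obtain ⟨y, hy, hwy, hyx⟩ := h w x hwx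
    have hX : above R y ⊆ X := fun u hu =>
      hw (mem_upper_singleton.1 (hu (mem_upper_singleton.2 hwy)))
    obtain ⟨p, hp, hpx⟩ := hy.2
    exact (rough_le_rough.1 (h₂ y hy (rough_mono hX))).1 (show p ∈ lower R (above R y) from hpx)
      (mem_upper_singleton.1 (hyx (mem_upper_singleton.2 hp)))
  · obtain ⟨x, hx, hwx⟩ := mem_upper.1 hw
    obtain ⟨y, hy, hwy, hyx⟩ := h w x hwx
    exact (rough_le_rough.1 (h₁ y hy ((hy.rough_singleton_le_iff hR).2 ⟨x, hx, hyx⟩))).2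
      (mem_upper_singleton.2 hwy)

theorem HasEnoughCorePoints.dmrs_le_of_forall (hR : ∀ x, R x x) (h : HasEnoughCorePoints R)
    {c d : DMRS R} (h₁ : ∀ y, IsCorePoint R y → rough R {y} ≤ c → rough R {y} ≤ d)
    (h₂ : ∀ y, IsCorePoint R y → rough R (above R y) ≤ c → rough R (above R y) ≤ d) :
    c ≤ d :=
  DMRS.le_of_forall_rough_le fun _ hX => DMRS.le_of_forall_le_rough fun _ hZ =>
    h.rough_le_of_forall hR (fun y hy hyX => (h₁ y hy (hyX.trans hX)).trans hZ)
      (fun y hy hyX => (h₂ y hy (hyX.trans hX)).trans hZ)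

theorem HasEnoughCorePoints.joinPrime_dense (hR : ∀ x, R x x) (h : HasEnoughCorePoints R)
    (c d : DMRS R) (hcd : ∀ j, IsCompletelyJoinPrime j → j ≤ c → j ≤ d) : c ≤ d :=
  h.dmrs_le_of_forall hR
    (fun _ hy => hcd _ (hy.isCompletelyJoinPrime_rough_singleton hR))
    (fun _ hy => hcd _ (hy.isCompletelyJoinPrime_rough_above hR))

theorem HasEnoughCorePoints.eq_rough_of_irreducible (hR : ∀ x, R x x)
    (h : HasEnoughCorePoints R) {j : DMRS R} (hj : IsCompletelyJoinIrreducible j) :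
    ∃ y, IsCorePoint R y ∧ (j = rough R {y} ∨ j = rough R (above R y)) := by
  have : j = sSup {c | c ≤ j ∧ ∃ y, IsCorePoint R y ∧
      (c = rough R {y} ∨ c = rough R (above R y))} := by
    refine le_antisymm (h.dmrs_le_of_forall hR ?_ ?_) (sSup_le fun c hc => hc.1)
    · exact fun y hy hyj => le_sSup ⟨hyj, y, hy, Or.inl rfl⟩
    · exact fun y hy hyj => le_sSup ⟨hyj, y, hy, Or.inr rfl⟩
  exact (hj.2 _ this).2

theorem rough_singleton_le_rough_above (y : U) : rough R {y} ≤ rough R (above R y) :=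
  rough_mono (Set.singleton_subset_iff.2 (subset_refl (upper R {y})))

theorem HasEnoughCorePoints.isAtom_rough_singleton (hR : ∀ x, R x x)
    (h : HasEnoughCorePoints R) {y : U} (hy : IsCorePoint R y) : IsAtom (rough R {y}) := by
  refine ⟨(hy.isCompletelyJoinPrime_rough_singleton hR).ne_bot, fun c hc => ?_⟩
  have key : ∀ z, IsCorePoint R z → ¬ rough R {z} ≤ c := fun z hz hzc => by
    refine hc.not_ge (le_trans ?_ hzc)
    obtain ⟨x, rfl, hx⟩ := (hz.rough_singleton_le_iff hR).1 (hzc.trans hc.le)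
    exact (hy.rough_singleton_le_iff hR).2 ⟨z, rfl, hy.1 z hx⟩
  exact le_bot_iff.1 (h.dmrs_le_of_forall hR (fun z hz hzc => absurd hzc (key z hz))
    (fun z hz hzc => absurd ((rough_singleton_le_rough_above z).trans hzc) (key z hz)))

theorem HasEnoughCorePoints.hasAtMostTwoLevels (hR : ∀ x, R x x)
    (h : HasEnoughCorePoints R) : HasAtMostTwoLevels (DMRS R) := by
  intro j k hj hk hjk
  obtain ⟨y, hy, rfl | rfl⟩ := h.eq_rough_of_irreducible hR hj
  · exact h.isAtom_rough_singleton hR hy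
  obtain ⟨z, hz, rfl | rfl⟩ := h.eq_rough_of_irreducible hR hk
  · exact absurd ((h.isAtom_rough_singleton hR hz).2 _ hjk) hj.1
  -- Comparable elements of the upper family coincide: `p` puts `y` in `above R z`, and minimality
  -- of `upper R {y}` reverses the inclusion.
  · refine absurd (rough_mono fun x hx => ?_) hjk.not_ge
    obtain ⟨p, hp, hpx⟩ := hy.2
    have hpz : p ∈ lower R (above R z) := (rough_le_rough.1 hjk.le).1 hpx
    exact (hz.exists_subset (hpz hp)).elim fun u hu => by
      obtain ⟨rfl, -⟩ := hu
      exact (hy.1 z (hpz hp)).trans hx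

/-! ### From the completion to core points -/

/-- Only the case where `y` is its own sole successor constrains the lower approximation; covering
`y` itself then forces `y ∈ X`. -/
theorem rough_singleton_le_sSup (hR : ∀ x, R x x) {y : U} {X : Set U}
    (h : upper R {y} ⊆ upper R X) : rough R {y} ≤ sSup ((fun x => rough R {x}) '' X) := by
  refine DMRS.le_of_forall_le_rough fun Z hZ => ?_
  have hXZ : ∀ x ∈ X, rough R {x} ≤ rough R Z := fun x hx =>
    (le_sSup (Set.mem_image_of_mem _ hx)).trans hZ
  obtain ⟨x, hx, hyx⟩ := mem_upper.1 (h (mem_upper_singleton.2 (hR y)))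
  refine (rough_singleton_le_iff hR).2 ⟨fun w hw => ?_, fun hy => ?_⟩
  · obtain ⟨x', hx', hwx'⟩ := mem_upper.1 (h hw)
    exact (rough_le_rough.1 (hXZ x' hx')).2 (mem_upper_singleton.2 hwx')
  · obtain rfl := hy x hyx
    exact ((rough_singleton_le_iff hR).1 (hXZ x hx)).2 hy

theorem rough_singleton_le_rough_singleton (hR : ∀ x, R x x) {y z : U} :
    rough R {y} ≤ rough R {z} ↔ upper R {y} ⊆ upper R {z} :=
  ⟨fun h => (rough_le_rough.1 h).2, fun h => by simpa using rough_singleton_le_sSup hR h⟩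

theorem IsCompletelyJoinIrreducible.eq_rough_singleton (hR : ∀ x, R x x) {j : DMRS R}
    (hj : IsCompletelyJoinIrreducible j) {x : U} (hjx : j ≤ rough R {x}) :
    ∃ y, j = rough R {y} := by
  -- A point in such a lower approximation must be `x`, giving `j = rough R {x}`. Otherwise only
  -- upper approximations matter, and `j` is a join of rough singletons.
  by_cases hcase : ∃ X v, rough R X ≤ j ∧ v ∈ lower R X
  · obtain ⟨X, v, hX, hv⟩ := hcase
    have hv' := (rough_le_rough.1 (hX.trans hjx)).1 hv
    obtain rfl : v = x := hv' (hR v)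
    exact ⟨v, le_antisymm hjx ((rough_mono (Set.singleton_subset_iff.2 (hv (hR v)))).trans hX)⟩
  · push Not at hcase
    have : j = sSup {c | c ≤ j ∧ ∃ y, c = rough R {y}} := by
      refine le_antisymm ?_ (sSup_le fun c hc => hc.1)
      refine DMRS.le_of_forall_rough_le fun X hX => DMRS.le_of_forall_le_rough fun Z hZ => ?_
      refine rough_le_rough.2 ⟨fun v hv => absurd hv (hcase X v hX), fun w hw => ?_⟩
      obtain ⟨y, hy, hwy⟩ := mem_upper.1 hw
      have hyj : rough R {y} ≤ j := (rough_mono (Set.singleton_subset_iff.2 hy)).trans hX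
      exact (rough_le_rough.1 ((le_sSup (show _ ∈ {c | c ≤ j ∧ ∃ y, c = rough R {y}} from
        ⟨hyj, y, rfl⟩)).trans hZ)).2 (mem_upper_singleton.2 hwy)
    exact (hj.2 _ this).2

theorem rough_singleton_le_of_not_le_neg {y : U} {c : DMRS R}
    (hc : ¬ c ≤ (rough R {y}).neg) : rough R {y} ≤ c := by
  by_contra hcon
  refine hc (DMRS.le_of_forall_rough_le fun X hX => ?_)
  rw [DMRS.neg_rough]
  refine rough_mono fun x hx hxy => hcon ?_
  obtain rfl : x = y := hxy
  exact (rough_mono (Set.singleton_subset_iff.2 hx)).trans hX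

/-- Here `m` is the largest element not above `rough R {z}`, so `m.neg` is the least one not below
`(rough R {z}).neg`, hence irreducible. It would lie strictly above `rough R {y}`, making `rough R
{z} < rough R {y} < m.neg` three levels. -/
theorem not_rough_singleton_lt (hL : IsCompletelyDistributive (DMRS R))
    (h2 : HasAtMostTwoLevels (DMRS R)) {y z : U}
    (hy : IsCompletelyJoinIrreducible (rough R {y}))
    (hz : IsCompletelyJoinIrreducible (rough R {z})) : ¬ rough R {z} < rough R {y} := by
  intro hlt
  set m : DMRS R := sSup {c | ¬ rough R {z} ≤ c}
  have hzm : ¬ rough R {z} ≤ m := fun h => by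
    obtain ⟨c, hc, hzc⟩ := hz.isCompletelyJoinPrime hL _ h
    exact hc hzc
  have hg : ¬ m.neg ≤ (rough R {z}).neg := by rwa [DMRS.neg_le_neg_iff]
  have hmin : ∀ c, ¬ c ≤ (rough R {z}).neg → m.neg ≤ c := fun c hc => by
    rw [DMRS.neg_le_comm]
    exact le_sSup fun h => hc (DMRS.le_neg_comm.1 h)
  have hgi : IsCompletelyJoinIrreducible m.neg := by
    refine ⟨fun h => hg (h ▸ bot_le), fun S hS => ?_⟩
    by_contra hmS
    refine hg (hS.le.trans (sSup_le fun c hc => ?_))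
    by_contra hcz
    have : m.neg = c := le_antisymm (hmin c hcz) (hS ▸ le_sSup hc)
    exact hmS (this ▸ hc)
  have hyz : rough R {y} ≤ (rough R {z}).neg :=
    rough_singleton_le_of_not_le_neg fun h => hlt.not_ge (DMRS.neg_le_neg_iff.1 h)
  have hyg : rough R {y} ≤ m.neg :=
    rough_singleton_le_of_not_le_neg fun h => hg (h.trans (DMRS.neg_le_neg hlt.le))
  have hne : rough R {y} ≠ m.neg := fun h => hg (h ▸ hyz)
  exact hz.1 ((h2 _ _ hy hgi (hyg.lt_of_ne hne)).2 _ hlt)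

theorem exists_irreducible_rough_singleton (hR : ∀ x, R x x) (hS : IsSpatial (DMRS R))
    {w x : U} (hwx : R w x) : ∃ y, IsCompletelyJoinIrreducible (rough R {y}) ∧ R w y ∧
      upper R {y} ⊆ upper R {x} := by
  set Z : Set U :=
    {y | IsCompletelyJoinIrreducible (rough R {y}) ∧ upper R {y} ⊆ upper R {x}}
  have hle : rough R {x} ≤ rough R Z := hS.le_of_forall fun j hj hjx => by
    obtain ⟨y, rfl⟩ := hj.eq_rough_singleton hR hjx
    exact rough_mono (Set.singleton_subset_iff.2
      ⟨hj, (rough_singleton_le_rough_singleton hR).1 hjx⟩)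
  obtain ⟨y, hy, hwy⟩ := mem_upper.1 ((rough_le_rough.1 hle).2 (mem_upper_singleton.2 hwx))
  exact ⟨y, hy.1, hwy, hy.2⟩

theorem hasEnoughCorePoints_of_twoLevels (hR : ∀ x, R x x) (hS : IsSpatial (DMRS R))
    (hL : IsCompletelyDistributive (DMRS R)) (h2 : HasAtMostTwoLevels (DMRS R)) :
    HasEnoughCorePoints R := by
  intro w x hwx
  obtain ⟨y, hy, hwy, hyx⟩ := exists_irreducible_rough_singleton hR hS hwx
  refine ⟨y, ⟨fun z hz => ?_, ?_⟩, hwy, hyx⟩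
  · obtain ⟨y', hy', -, hyz⟩ := exists_irreducible_rough_singleton hR hS (hR z)
    refine subset_trans ?_ hyz
    by_contra hcon
    exact not_rough_singleton_lt hL h2 hy hy' (lt_of_le_not_ge
      ((rough_singleton_le_rough_singleton hR).2 (hyz.trans hz))
      fun h => hcon ((rough_singleton_le_rough_singleton hR).1 h))
  -- Join-primeness prevents the sets `upper R {x}` not containing `upper R {y}` from jointly
  -- covering it; an uncovered point is `p`.
  · have hX : ¬ upper R {y} ⊆ upper R {x | ¬ upper R {y} ⊆ upper R {x}} := fun h => by
      obtain ⟨_, ⟨z, hz, rfl⟩, hyz⟩ :=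
        hy.isCompletelyJoinPrime hL _ (rough_singleton_le_sSup hR h)
      exact hz ((rough_singleton_le_rough_singleton hR).1 hyz)
    obtain ⟨p, hp, hpX⟩ := Set.not_subset.1 hX
    refine ⟨p, mem_upper_singleton.1 hp, fun z hz => ?_⟩
    by_contra hcon
    exact hpX (mem_upper.2 ⟨z, hcon, hz⟩)

end Relation

end RoughSet

theorem mainTheorem4 {U : Type*} (R : U → U → Prop) (hR : ∀ x, R x x) :
    List.TFAE [
      RoughSet.IsSpatial (RoughSet.DMRS R) ∧
        RoughSet.IsCompletelyDistributive (RoughSet.DMRS R) ∧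
        RoughSet.IsPseudocomplementedKleeneAlgebra (RoughSet.DMRS R) RoughSet.DMRS.neg ∧
        RoughSet.IsRegular (RoughSet.DMRS R),
      RoughSet.IsSpatial (RoughSet.DMRS R) ∧
        RoughSet.IsCompletelyDistributive (RoughSet.DMRS R) ∧
        RoughSet.HasAtMostTwoLevels (RoughSet.DMRS R),
      IsAtomistic (RoughSet.UpperApprox R) ∧
        RoughSet.IsBooleanLattice (RoughSet.UpperApprox R)] := by
  tfae_have 1 → 2
  | ⟨hS, hL, hK, hreg⟩ => ⟨hS, hL, RoughSet.twoLevels_of_isRegular hS hL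
      hK.exists_pseudocompl hK.exists_dualPseudocompl hreg⟩
  tfae_have 2 → 1
  | ⟨hS, hL, h2⟩ => ⟨hS, hL,
      { toIsKleeneAlgebra := RoughSet.DMRS.isKleeneAlgebra hR
          (RoughSet.isDistributive_of_spatial hS hL)
        exists_pseudocompl := RoughSet.exists_isPseudocompl_of_spatial hS hL },
      RoughSet.isRegular_of_twoLevels hS hL h2⟩
  tfae_have 2 → 3
  | ⟨hS, hL, h2⟩ =>
    have h := RoughSet.hasEnoughCorePoints_of_twoLevels hR hS hL h2
    ⟨h.isAtomistic hR, h.isBooleanLattice hR⟩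
  tfae_have 3 → 2
  | ⟨hA, hB⟩ =>
    have h := RoughSet.hasEnoughCorePoints_of_isBooleanLattice hR hA hB
    ⟨RoughSet.isSpatial_of_joinPrime (h.joinPrime_dense hR),
      RoughSet.isCompletelyDistributive_of_joinPrime (h.joinPrime_dense hR),
      h.hasAtMostTwoLevels hR⟩
  tfae_finish
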